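/- Let $\mu$ be a Borel probability measure on $\mathbb{R}$. For $\alpha,\beta>0$ put $\Delta_{\alpha,\beta}=\{z=x+iy\in\mathbb{C} : |x|<-\alpha y,\ |z|<\beta\}$, let $G_\mu(z)=\int_{\mathbb{R}}\frac{d\mu(t)}{z-t}$ be the Cauchy transform of $\mu$ on the upper half-plane, and let $\mathcal{D}_{\alpha,\beta}$ be the image of $\Delta_{\alpha,\beta}$ under $z\mapsto G_\mu(1/z)$. For every $\alpha>0$ and all sufficiently small $\beta>0$ (depending on $\mu$ and $\alpha$) this map is injective on $\Delta_{\alpha,\beta}$; with $L_\mu:\mathcal{D}_{\alpha,\beta}\to\Delta_{\alpha,\beta}$ its inverse, the $R$-transform of $\mu$ on $\mathcal{D}_{\alpha,\beta}$ is $R_\mu(w)=\frac{1}{L_\mu(w)}-\frac1w$. Then $\mu$ is compactly supported if and only if $R_\mu$ extends analytically, with real Taylor coefficients at $0$, to an open ball centred at $0$; that is, if and only if there are $r>0$ and an analytic function $F:\{|w|<r\}\to\mathbb{C}$, all of whose Taylor coefficients at $0$ are real, such that for every $\alpha>0$ and all sufficiently small $\beta>0$ one has $\mathcal{D}_{\alpha,\beta}\subseteq\{|w|<r\}$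 and $F=R_\mu$ on $\mathcal{D}_{\alpha,\beta}$. -/

import Mathlib

open Filter Topology MeasureTheory

noncomputable section

/-- The Cauchy transform `G_μ(z) = ∫ dμ(t) / (z - t)`; the integrand is bounded in `t` (hence
integrable for finite `μ`) whenever `z` is not real. -/
def cauchyTransform (μ : Measure ℝ) (z : ℂ) : ℂ :=
  ∫ t : ℝ, (z - (t : ℂ))⁻¹ ∂μ

/-- The truncated cone `Δ_{α,β} = {z = x + iy : |x| < -α y, |z| < β}` with vertex `0`
in the lower half-plane. -/
def truncatedCone (α β : ℝ) : Set ℂ :=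
  {z : ℂ | |z.re| < -α * z.im ∧ ‖z‖ < β}

/-- The function `z ↦ G_μ(1/z)`. -/
def cauchyInv (μ : Measure ℝ) (z : ℂ) : ℂ :=
  cauchyTransform μ z⁻¹

/-- The set `𝓓_{α,β}`, the image of `Δ_{α,β}` under `z ↦ G_μ(1/z)`. -/
def coneImage (μ : Measure ℝ) (α β : ℝ) : Set ℂ :=
  cauchyInv μ '' truncatedCone α β

/-- The function `L_μ` on `𝓓_{α,β}`: the inverse of the restriction of `z ↦ G_μ(1/z)` to
`Δ_{α,β}`. For each `α > 0` that restriction is injective as soon as `β` is small enough;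
values outside `𝓓_{α,β}` have no meaning. -/
def inverseOnCone (μ : Measure ℝ) (α β : ℝ) : ℂ → ℂ :=
  Function.invFunOn (cauchyInv μ) (truncatedCone α β)

/-- The R-transform on `𝓓_{α,β}`: `R_μ(w) = K_μ(w) - 1/w`, where `K_μ = 1 / L_μ`. -/
def rTransform (μ : Measure ℝ) (α β : ℝ) (w : ℂ) : ℂ :=
  (inverseOnCone μ α β w)⁻¹ - w⁻¹

/-- `F` is an analytic extension to the open ball of radius `r` about `0` of the R-transform
of `μ`: it is analytic on the ball and, for every opening `α`, it coincides with `R_μ` on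
`𝓓_{α,β}` for all small enough `β` (for those `β` one has `𝓓_{α,β} ⊆ B(0, r)`). -/
structure IsAnalyticExtensionOfRTransform (μ : Measure ℝ) (r : ℝ) (F : ℂ → ℂ) : Prop where
  analytic : AnalyticOnNhd ℂ F (Metric.ball 0 r)
  eqOn : ∀ α : ℝ, 0 < α → ∀ᶠ β : ℝ in 𝓝[>] 0,
    coneImage μ α β ⊆ Metric.ball 0 r ∧ Set.EqOn F (rTransform μ α β) (coneImage μ α β)

end

/-! Write `g(z) = G_μ(1/z) = z ∫ (1 - zt)⁻¹ dμ(t)`. On a cone in the lower half-plane the integrand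
is bounded uniformly in `t`, so `g(z)/z → 1` at the vertex.

If `μ` has compact support, the bound holds on a full punctured disc. The singularity of `g` at `0`
is then removable, and `g` is tangent to the identity and commutes with conjugation
(`analyticAt_update_cauchyInv`). Its local inverse `L` inherits this, and `1/L(w) - 1/w` is analytic
at `0`.

Conversely, given `F`, the germ `w/(1 + wF(w))` inverts `g` on a small cone, so its local inverse
`h` equals `g` there, hence on a lower half-disc of radius `ρ` by the identity theorem. Real
coefficients make `h` real on the real axis. So `Im G_μ(x + iε) → 0` for `|x| > 1/ρ`, and Stieltjes
inversion (`measure_eq_zero_of_tendsto_im_cauchyTransform`) shows that `μ` has no mass there. -/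

/-! ### Conjugation-symmetric analytic germs and their inverses. -/

/-- `f` commutes with complex conjugation near `0`. -/
def ConjSymmetricAtZero (f : ℂ → ℂ) : Prop :=
  ∀ᶠ z in 𝓝 (0 : ℂ), f (starRingEnd ℂ z) = starRingEnd ℂ (f z)

theorem tendsto_conj_nhds_zero : Tendsto (starRingEnd ℂ) (𝓝 0) (𝓝 0) := by
  simpa using (Complex.continuous_conj.tendsto 0)

theorem iteratedDeriv_conj_conj (f : ℂ → ℂ) (n : ℕ) :
    iteratedDeriv n (fun z => starRingEnd ℂ (f (starRingEnd ℂ z))) =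
      fun z => starRingEnd ℂ (iteratedDeriv n f (starRingEnd ℂ z)) := by
  induction n with
  | zero => simp
  | succ n ih =>
    funext z
    rw [iteratedDeriv_succ, ih, iteratedDeriv_succ]
    simpa [Function.comp_def] using congrFun (deriv_conj_conj (f := iteratedDeriv n f)) z

theorem ConjSymmetricAtZero.im_iteratedDeriv {f : ℂ → ℂ} (h : ConjSymmetricAtZero f) (n : ℕ) :
    (iteratedDeriv n f 0).im = 0 := by
  have h1 : f =ᶠ[𝓝 0] fun z => starRingEnd ℂ (f (starRingEnd ℂ z)) := by
    filter_upwards [h] with z hz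
    rw [hz, Complex.conj_conj]
  have h2 := h1.iteratedDeriv_eq n
  rw [iteratedDeriv_conj_conj] at h2
  simp only [map_zero] at h2
  exact Complex.conj_eq_iff_im.1 h2.symm

theorem AnalyticAt.conjSymmetricAtZero {f : ℂ → ℂ} (hf : AnalyticAt ℂ f 0)
    (h : ∀ n, (iteratedDeriv n f 0).im = 0) : ConjSymmetricAtZero f := by
  obtain ⟨r, hr, hb⟩ := Metric.eventually_nhds_iff_ball.1 hf.eventually_analyticAt
  have hd : DifferentiableOn ℂ f (Metric.ball 0 r) := fun z hz =>
    (hb z hz).differentiableAt.differentiableWithinAt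
  filter_upwards [Metric.ball_mem_nhds (0 : ℂ) hr] with z hz
  have hz' : starRingEnd ℂ z ∈ Metric.ball (0 : ℂ) r := by simpa using hz
  have h1 := Complex.hasSum_taylorSeries_on_ball hd hz'
  have h2 := (Complex.hasSum_taylorSeries_on_ball hd hz).map (starRingEnd ℂ)
    Complex.continuous_conj
  refine h1.unique (h2.congr_fun ?_)
  intro n
  simp [Complex.conj_eq_iff_im.2 (h n)]

theorem AnalyticAt.exists_conjSymmetric_inverse {f : ℂ → ℂ} (hf : AnalyticAt ℂ f 0) (h0 : f 0 = 0)
    (h1 : deriv f 0 = 1) (hs : ConjSymmetricAtZero f) :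
    ∃ g : ℂ → ℂ, AnalyticAt ℂ g 0 ∧ g 0 = 0 ∧ deriv g 0 = 1 ∧ ConjSymmetricAtZero g ∧
      (∀ᶠ z in 𝓝 0, g (f z) = z) ∧ ∀ᶠ w in 𝓝 0, f (g w) = w := by
  have hne : deriv f 0 ≠ 0 := by rw [h1]; exact one_ne_zero
  have hS := hf.hasStrictDerivAt
  set g := hS.localInverse f (deriv f 0) 0 hne with hg
  have ga : AnalyticAt ℂ g 0 := by
    have := hf.analyticAt_localInverse hne
    rwa [h0] at this
  have gl : ∀ᶠ z in 𝓝 0, g (f z) = z := HasStrictFDerivAt.eventually_left_inverse _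
  have gr : ∀ᶠ w in 𝓝 0, f (g w) = w := by
    have : ∀ᶠ w in 𝓝 (f 0), f (g w) = w := HasStrictFDerivAt.eventually_right_inverse _
    rwa [h0] at this
  have g0 : g 0 = 0 := by
    have := gl.self_of_nhds
    rwa [h0] at this
  have gt : Tendsto g (𝓝 0) (𝓝 0) := by
    simpa [g0] using ga.continuousAt.tendsto
  refine ⟨g, ga, g0, ?_, ?_, gl, gr⟩
  · have := hS.to_localInverse hne
    rw [← hg, h0] at this
    rw [this.hasDerivAt.deriv, h1, inv_one]
  -- Symmetry of `f` gives `f (conj (g w)) = conj w`; applying `g` gives the symmetry of `g`.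
  · filter_upwards [gr, gt.eventually hs, (tendsto_conj_nhds_zero.comp gt).eventually gl]
      with w hw h2 h3
    simp only [Function.comp_apply] at h3
    rwa [h2, hw] at h3

theorem eventually_nhds_of_eventually_nhdsNE_of_continuousAt {f g : ℂ → ℂ} {z : ℂ}
    (hf : ContinuousAt f z) (hg : ContinuousAt g z) (h : ∀ᶠ w in 𝓝[≠] z, f w = g w) :
    ∀ᶠ w in 𝓝 z, f w = g w :=
  (hf.eventuallyEq_nhds_iff_eventuallyEq_nhdsNE hg).1 h

theorem AnalyticAt.analyticAt_dslope {f : ℂ → ℂ} {c : ℂ} (hf : AnalyticAt ℂ f c) :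
    AnalyticAt ℂ (dslope f c) c := by
  obtain ⟨p, hp⟩ := hf
  exact ⟨_, hp.has_fpower_series_dslope_fslope⟩

/-- Regularisation at `0` of `w ↦ (L w)⁻¹ - w⁻¹` for `L` tangent to the identity. -/
theorem exists_analytic_inv_sub_inv {L : ℂ → ℂ} (hL : AnalyticAt ℂ L 0) (h0 : L 0 = 0)
    (h1 : deriv L 0 = 1) (hs : ConjSymmetricAtZero L) :
    ∃ F : ℂ → ℂ, AnalyticAt ℂ F 0 ∧ ConjSymmetricAtZero F ∧
      ∀ w, w ≠ 0 → F w = (L w)⁻¹ - w⁻¹ := by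
  have hl := hL.analyticAt_dslope
  have hl0 : dslope L 0 0 = 1 := by rw [dslope_same, h1]
  have hF : AnalyticAt ℂ (dslope (fun w => (dslope L 0 w)⁻¹) 0) 0 :=
    (hl.inv (by rw [hl0]; exact one_ne_zero)).analyticAt_dslope
  have hform : ∀ w, w ≠ 0 → dslope (fun w => (dslope L 0 w)⁻¹) 0 w = (L w)⁻¹ - w⁻¹ := by
    intro w hw
    rw [dslope_of_ne _ hw, slope_def_field, hl0, dslope_of_ne _ hw, slope_def_field, h0]
    -- With `0⁻¹ = 0` the formula survives at other zeros of `L`: both sides are `-w⁻¹`.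
    rcases eq_or_ne (L w) 0 with h | h
    · simp [h]
      field_simp
    · field_simp
      simp
  refine ⟨_, hF, ?_, hform⟩
  refine eventually_nhds_of_eventually_nhdsNE_of_continuousAt
    (ContinuousAt.comp' (by simpa using hF.continuousAt) Complex.continuous_conj.continuousAt)
    (Complex.continuous_conj.continuousAt.comp' hF.continuousAt) ?_
  filter_upwards [hs.filter_mono nhdsWithin_le_nhds, self_mem_nhdsWithin] with w hw hw0
  have hw1 : w ≠ 0 := hw0
  rw [hform _ hw1, hform _ (by simpa using hw1), hw]
  simp

/-- Converse regularisation: `w ↦ (F w + w⁻¹)⁻¹` is tangent to the identity at `0`. -/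
theorem analyticAt_div_one_add_mul {F : ℂ → ℂ} (hF : AnalyticAt ℂ F 0)
    (hs : ConjSymmetricAtZero F) :
    AnalyticAt ℂ (fun w => w / (1 + w * F w)) 0 ∧ deriv (fun w => w / (1 + w * F w)) 0 = 1 ∧
      ConjSymmetricAtZero (fun w => w / (1 + w * F w)) := by
  have ha : AnalyticAt ℂ (fun w => 1 + w * F w) 0 := analyticAt_const.add (analyticAt_id.mul hF)
  refine ⟨analyticAt_id.div ha (by simp), ?_, ?_⟩
  · have := (hasDerivAt_id (0 : ℂ)).div ha.differentiableAt.hasDerivAt (by simp)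
    simpa [Pi.div_def] using this.deriv
  · filter_upwards [hs] with w hw
    simp [hw]

/-! ### Asymptotics of `G_μ(1/z)` at `0`. -/

theorem cauchyInv_eq_mul (μ : Measure ℝ) {z : ℂ} (hz : z ≠ 0) :
    cauchyInv μ z = z * ∫ t : ℝ, (1 - z * (t : ℂ))⁻¹ ∂μ := by
  rw [cauchyInv, cauchyTransform, ← integral_const_mul]
  congr 1
  funext t
  have : z⁻¹ - (t : ℂ) = z⁻¹ * (1 - z * t) := by field_simp
  rw [this, mul_inv, inv_inv]

theorem measurable_inv_one_sub_mul (z : ℂ) : Measurable fun t : ℝ => (1 - z * (t : ℂ))⁻¹ := by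
  fun_prop

/-- Dominated convergence with two parameters: `v = 0` gives `g(z)/z → 1`, while two free points
control the difference quotients of `g`. -/
theorem tendsto_integral_inv_mul_inv (μ : Measure ℝ) [IsProbabilityMeasure μ] {ι : Type*}
    {l : Filter ι} [l.IsCountablyGenerated] {u v : ι → ℂ} (hu : Tendsto u l (𝓝 0))
    (hv : Tendsto v l (𝓝 0)) {C : ℝ}
    (hbu : ∀ᶠ i in l, ∀ᵐ t : ℝ ∂μ, ‖(1 - u i * (t : ℂ))⁻¹‖ ≤ C)
    (hbv : ∀ᶠ i in l, ∀ᵐ t : ℝ ∂μ, ‖(1 - v i * (t : ℂ))⁻¹‖ ≤ C) :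
    Tendsto (fun i => ∫ t : ℝ, (1 - u i * (t : ℂ))⁻¹ * (1 - v i * (t : ℂ))⁻¹ ∂μ) l (𝓝 1) := by
  have key : Tendsto (fun i => ∫ t : ℝ, (1 - u i * (t : ℂ))⁻¹ * (1 - v i * (t : ℂ))⁻¹ ∂μ) l
      (𝓝 (∫ _ : ℝ, (1 : ℂ) ∂μ)) := by
    refine tendsto_integral_filter_of_dominated_convergence (fun _ => C * C) ?_ ?_
      (integrable_const _) ?_
    · exact Eventually.of_forall fun i =>
        ((measurable_inv_one_sub_mul _).mul (measurable_inv_one_sub_mul _)).aestronglyMeasurable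
    · filter_upwards [hbu, hbv] with i h1 h2
      filter_upwards [h1, h2] with t h1 h2
      rw [norm_mul]
      exact mul_le_mul h1 h2 (norm_nonneg _) ((norm_nonneg _).trans h1)
    · refine Eventually.of_forall fun t => ?_
      have h : ∀ {w : ι → ℂ}, Tendsto w l (𝓝 0) →
          Tendsto (fun i => (1 - w i * (t : ℂ))⁻¹) l (𝓝 1) := fun {w} hw => by
        have : Tendsto (fun i => 1 - w i * (t : ℂ)) l (𝓝 (1 - 0 * (t : ℂ))) :=
          tendsto_const_nhds.sub (hw.mul_const _)
        simpa using this.inv₀ (by simp)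
      simpa using (h hu).mul (h hv)
  simpa using key

theorem tendsto_cauchyInv_div (μ : Measure ℝ) [IsProbabilityMeasure μ] {l : Filter ℂ}
    [l.IsCountablyGenerated] (hl : l ≤ 𝓝[≠] 0) {C : ℝ}
    (hb : ∀ᶠ z in l, ∀ᵐ t : ℝ ∂μ, ‖(1 - z * (t : ℂ))⁻¹‖ ≤ C) :
    Tendsto (fun z => cauchyInv μ z / z) l (𝓝 1) := by
  have h := tendsto_integral_inv_mul_inv μ (u := id) (v := fun _ => 0) (C := max C 1)
    (hl.trans nhdsWithin_le_nhds) tendsto_const_nhds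
    (by filter_upwards [hb] with z hz
        filter_upwards [hz] with t ht using ht.trans (le_max_left _ _)) (by simp)
  refine h.congr' ?_
  filter_upwards [hl self_mem_nhdsWithin] with z hz
  have hz : z ≠ 0 := hz
  rw [cauchyInv_eq_mul μ hz, mul_div_cancel_left₀ _ hz]
  simp

theorem tendsto_cauchyInv_zero (μ : Measure ℝ) [IsProbabilityMeasure μ] {l : Filter ℂ}
    [l.IsCountablyGenerated] (hl : l ≤ 𝓝[≠] 0) {C : ℝ}
    (hb : ∀ᶠ z in l, ∀ᵐ t : ℝ ∂μ, ‖(1 - z * (t : ℂ))⁻¹‖ ≤ C) :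
    Tendsto (cauchyInv μ) l (𝓝 0) := by
  have h := (tendsto_cauchyInv_div μ hl hb).mul
    (show Tendsto (fun z : ℂ => z) l (𝓝 0) from hl.trans nhdsWithin_le_nhds)
  rw [one_mul] at h
  refine h.congr' ?_
  filter_upwards [hl self_mem_nhdsWithin] with z hz
  exact div_mul_cancel₀ _ hz

/-! ### Bounds and injectivity on cones. -/

/-- The infinite cone with vertex `0` and opening `α` in the lower half-plane. -/
def lowerCone (α : ℝ) : Set ℂ := {z : ℂ | |z.re| < -α * z.im}

theorem im_neg_of_mem_lowerCone {α : ℝ} (hα : 0 < α) {z : ℂ} (hz : z ∈ lowerCone α) :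
    z.im < 0 := by
  have h : 0 < -α * z.im := (abs_nonneg _).trans_lt hz
  nlinarith

theorem ne_zero_of_im_neg {z : ℂ} (hz : z.im < 0) : z ≠ 0 := by
  rintro rfl
  simp at hz

theorem one_sub_mul_ne_zero {z : ℂ} (hz : z.im < 0) (t : ℝ) : 1 - z * (t : ℂ) ≠ 0 := by
  intro h
  have him := congrArg Complex.im h
  have hre := congrArg Complex.re h
  simp at him hre
  rcases him with h1 | h1
  · exact hz.ne h1
  · simp [h1] at hre

/-- `(1 - zt) z̄` has imaginary part `-Im z` whatever `t` is, and `|z| ≤ (1 + α)|Im z|` on the cone.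
-/
theorem norm_inv_one_sub_mul_le {α : ℝ} (hα : 0 < α) {z : ℂ} (hz : z ∈ lowerCone α) (t : ℝ) :
    ‖(1 - z * (t : ℂ))⁻¹‖ ≤ 1 + α := by
  have hi := im_neg_of_mem_lowerCone hα hz
  have h1 : -z.im ≤ ‖1 - z * (t : ℂ)‖ * ‖z‖ := by
    have := Complex.abs_im_le_norm ((1 - z * (t : ℂ)) * starRingEnd ℂ z)
    rw [norm_mul, Complex.norm_conj] at this
    refine le_trans (le_trans (le_of_eq ?_) (le_abs_self _)) this
    simp
    ring
  have h2 : ‖z‖ ≤ (1 + α) * -z.im := by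
    have := Complex.norm_le_abs_re_add_abs_im z
    rw [abs_of_neg hi] at this
    have h3 : |z.re| < -α * z.im := hz
    linarith
  have hp : 0 < ‖1 - z * (t : ℂ)‖ := norm_pos_iff.2 (one_sub_mul_ne_zero hi t)
  rw [norm_inv, inv_le_iff_one_le_mul₀ hp]
  have h3 := mul_le_mul_of_nonneg_left h2 hp.le
  have h4 : -z.im * 1 ≤ -z.im * ((1 + α) * ‖1 - z * (t : ℂ)‖) := by nlinarith
  exact le_of_mul_le_mul_left h4 (by linarith)

theorem nhdsWithin_lowerCone_le {α : ℝ} (hα : 0 < α) : 𝓝[lowerCone α] (0 : ℂ) ≤ 𝓝[≠] 0 :=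
  nhdsWithin_mono _ fun _ hz => ne_zero_of_im_neg (im_neg_of_mem_lowerCone hα hz)

theorem eventually_lowerCone_bound (μ : Measure ℝ) {α : ℝ} (hα : 0 < α) :
    ∀ᶠ z in 𝓝[lowerCone α] (0 : ℂ), ∀ᵐ t : ℝ ∂μ, ‖(1 - z * (t : ℂ))⁻¹‖ ≤ 1 + α := by
  filter_upwards [self_mem_nhdsWithin] with z hz
  exact Eventually.of_forall (norm_inv_one_sub_mul_le hα hz)

/-- Reduces "for all small `β`" to a limit along one filter. -/
theorem eventually_truncatedCone {α : ℝ} {p : ℂ → Prop} (h : ∀ᶠ z in 𝓝[lowerCone α] 0, p z) :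
    ∀ᶠ β : ℝ in 𝓝[>] 0, ∀ z ∈ truncatedCone α β, p z := by
  obtain ⟨ε, hε, hb⟩ := Metric.mem_nhdsWithin_iff.1 h
  filter_upwards [Ioo_mem_nhdsGT hε] with β hβ z hz
  exact hb ⟨by simpa using hz.2.trans hβ.2, hz.1⟩

theorem integrable_inv_one_sub_mul (μ : Measure ℝ) [IsProbabilityMeasure μ] {α : ℝ} (hα : 0 < α)
    {z : ℂ} (hz : z ∈ lowerCone α) : Integrable (fun t : ℝ => (1 - z * (t : ℂ))⁻¹) μ :=
  Integrable.of_bound (measurable_inv_one_sub_mul z).aestronglyMeasurable (1 + α)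
    (Eventually.of_forall (norm_inv_one_sub_mul_le hα hz))

theorem cauchyInv_sub (μ : Measure ℝ) [IsProbabilityMeasure μ] {α : ℝ} (hα : 0 < α)
    {z w : ℂ} (hz : z ∈ lowerCone α) (hw : w ∈ lowerCone α) :
    cauchyInv μ z - cauchyInv μ w =
      (z - w) * ∫ t : ℝ, (1 - z * (t : ℂ))⁻¹ * (1 - w * (t : ℂ))⁻¹ ∂μ := by
  have hzi := im_neg_of_mem_lowerCone hα hz
  have hwi := im_neg_of_mem_lowerCone hα hw
  rw [cauchyInv_eq_mul μ (ne_zero_of_im_neg hzi), cauchyInv_eq_mul μ (ne_zero_of_im_neg hwi),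
    ← integral_const_mul, ← integral_const_mul, ← integral_const_mul,
    ← integral_sub ((integrable_inv_one_sub_mul μ hα hz).const_mul _)
      ((integrable_inv_one_sub_mul μ hα hw).const_mul _)]
  congr 1
  funext t
  have h1 := one_sub_mul_ne_zero hzi t
  have h2 := one_sub_mul_ne_zero hwi t
  have e : z - w = z * (1 - w * t) - w * (1 - z * t) := by ring
  rw [e]
  generalize 1 - z * (t : ℂ) = a at h1
  generalize 1 - w * (t : ℂ) = b at h2
  field_simp

/-- For every opening `α`, `z ↦ G_μ(1/z)` is injective on small truncated cones. -/
theorem eventually_injOn_truncatedCone (μ : Measure ℝ) [IsProbabilityMeasure μ] {α : ℝ}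
    (hα : 0 < α) : ∀ᶠ β : ℝ in 𝓝[>] 0, Set.InjOn (cauchyInv μ) (truncatedCone α β) := by
  have hid : 𝓝[lowerCone α] (0 : ℂ) ≤ 𝓝 0 := nhdsWithin_le_nhds
  have hb := eventually_lowerCone_bound μ hα
  have hlim := tendsto_integral_inv_mul_inv μ
    (l := 𝓝[lowerCone α] (0 : ℂ) ×ˢ 𝓝[lowerCone α] (0 : ℂ))
    (tendsto_fst.mono_right hid) (tendsto_snd.mono_right hid)
    (tendsto_fst.eventually hb) (tendsto_snd.eventually hb)
  have hne := hlim.eventually_ne one_ne_zero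
  obtain ⟨p, hp, q, hq, hpq⟩ := eventually_prod_iff.1 hne
  filter_upwards [eventually_truncatedCone (hp.and hq)] with β hβ z hz w hw h
  have h1 := cauchyInv_sub μ hα hz.1 hw.1
  rw [h, sub_self] at h1
  exact sub_eq_zero.1 ((mul_eq_zero.1 h1.symm).resolve_right (hpq (hβ z hz).1 (hβ w hw).2))

theorem inverseOnCone_cauchyInv {μ : Measure ℝ} {α β : ℝ}
    (h : Set.InjOn (cauchyInv μ) (truncatedCone α β)) {z : ℂ} (hz : z ∈ truncatedCone α β) :
    inverseOnCone μ α β (cauchyInv μ z) = z :=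
  h.leftInvOn_invFunOn hz

/-! ### Analyticity and conjugation symmetry of `G_μ(1/z)`. -/

theorem differentiableAt_cauchyTransform (μ : Measure ℝ) [IsProbabilityMeasure μ] {z : ℂ} {d : ℝ}
    (hd : 0 < d) (h : ∀ᵐ t : ℝ ∂μ, d ≤ ‖z - (t : ℂ)‖) :
    DifferentiableAt ℂ (cauchyTransform μ) z := by
  have hlow : ∀ᵐ t : ℝ ∂μ, ∀ w ∈ Metric.ball z (d / 2), d / 2 ≤ ‖w - (t : ℂ)‖ := by
    filter_upwards [h] with t ht w hw
    have h1 : ‖w - z‖ < d / 2 := by simpa [dist_eq_norm] using hw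
    have h2 := norm_sub_le_norm_sub_add_norm_sub z w (t : ℂ)
    rw [norm_sub_rev z w] at h2
    linarith
  refine (hasDerivAt_integral_of_dominated_loc_of_deriv_le (bound := fun _ => ((d / 2) ^ 2)⁻¹)
    (F := fun w (t : ℝ) => (w - (t : ℂ))⁻¹) (F' := fun w (t : ℝ) => -((w - (t : ℂ)) ^ 2)⁻¹)
    (Metric.ball_mem_nhds z (half_pos hd)) ?_ ?_ ?_ ?_ (integrable_const _) ?_).2.differentiableAt
  · exact Eventually.of_forall fun w =>
      (by fun_prop : Measurable fun t : ℝ => (w - (t : ℂ))⁻¹).aestronglyMeasurable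
  · refine Integrable.of_bound
      (by fun_prop : Measurable fun t : ℝ => (z - (t : ℂ))⁻¹).aestronglyMeasurable d⁻¹ ?_
    filter_upwards [h] with t ht
    rw [norm_inv]
    exact inv_anti₀ hd ht
  · exact (by fun_prop : Measurable fun t : ℝ => -((z - (t : ℂ)) ^ 2)⁻¹).aestronglyMeasurable
  · filter_upwards [hlow] with t ht w hw
    rw [norm_neg, norm_inv, norm_pow]
    exact inv_anti₀ (by positivity) (pow_le_pow_left₀ (by positivity) (ht w hw) 2)
  · filter_upwards [hlow] with t ht w hw
    have hne : w - (t : ℂ) ≠ 0 := norm_pos_iff.1 ((half_pos hd).trans_le (ht w hw))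
    have := ((hasDerivAt_id w).sub_const (t : ℂ)).inv hne
    simpa [neg_div, Pi.inv_def] using this

theorem differentiableAt_cauchyInv (μ : Measure ℝ) [IsProbabilityMeasure μ] {z : ℂ} (hz : z ≠ 0)
    {d : ℝ} (hd : 0 < d) (h : ∀ᵐ t : ℝ ∂μ, d ≤ ‖z⁻¹ - (t : ℂ)‖) :
    DifferentiableAt ℂ (cauchyInv μ) z :=
  (differentiableAt_cauchyTransform μ hd h).comp z (differentiableAt_inv hz)

theorem differentiableAt_cauchyInv_of_im_neg (μ : Measure ℝ) [IsProbabilityMeasure μ] {z : ℂ}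
    (hz : z.im < 0) : DifferentiableAt ℂ (cauchyInv μ) z := by
  have h0 := ne_zero_of_im_neg hz
  have hpos : 0 < z⁻¹.im := by
    rw [Complex.inv_im]
    exact div_pos (by linarith) (Complex.normSq_pos.2 h0)
  refine differentiableAt_cauchyInv μ h0 hpos (Eventually.of_forall fun t => ?_)
  refine le_trans (le_trans (le_of_eq ?_) (le_abs_self _)) (Complex.abs_im_le_norm _)
  simp

theorem cauchyInv_conj (μ : Measure ℝ) (z : ℂ) :
    cauchyInv μ (starRingEnd ℂ z) = starRingEnd ℂ (cauchyInv μ z) := by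
  rw [cauchyInv, cauchyInv, cauchyTransform, cauchyTransform, ← integral_conj]
  congr 1
  funext t
  simp

theorem half_le_norm_one_sub_mul {M : ℝ} (hM : 0 < M) {z : ℂ} (hz : ‖z‖ < (2 * M)⁻¹) {t : ℝ}
    (ht : |t| ≤ M) : 1 / 2 ≤ ‖1 - z * (t : ℂ)‖ := by
  have h1 : ‖z * (t : ℂ)‖ ≤ (2 * M)⁻¹ * M := by
    rw [norm_mul, Complex.norm_real, Real.norm_eq_abs]
    exact mul_le_mul hz.le ht (abs_nonneg _) (by positivity)
  have h2 : (2 * M)⁻¹ * M = 1 / 2 := by field_simp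
  have h3 := norm_sub_norm_le (1 : ℂ) (z * (t : ℂ))
  rw [norm_one] at h3
  linarith

/-- Removable singularity. The update is needed because `cauchyInv μ 0` is a junk value, coming from
`0⁻¹ = 0`. -/
theorem analyticAt_update_cauchyInv (μ : Measure ℝ) [IsProbabilityMeasure μ] {M : ℝ} (hM : 0 < M)
    (h : ∀ᵐ t ∂μ, |t| ≤ M) :
    AnalyticAt ℂ (Function.update (cauchyInv μ) 0 0) 0 ∧
      deriv (Function.update (cauchyInv μ) 0 0) 0 = 1 := by
  have hsmall : ∀ᶠ z in 𝓝[≠] (0 : ℂ), ‖z‖ < (2 * M)⁻¹ := by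
    filter_upwards [nhdsWithin_le_nhds (Metric.ball_mem_nhds (0 : ℂ)
      (show (0 : ℝ) < (2 * M)⁻¹ by positivity))] with z hz
    simpa using hz
  have hb : ∀ᶠ z in 𝓝[≠] (0 : ℂ), ∀ᵐ t : ℝ ∂μ, ‖(1 - z * (t : ℂ))⁻¹‖ ≤ 2 := by
    filter_upwards [hsmall] with z hz
    filter_upwards [h] with t ht
    rw [norm_inv]
    have := inv_anti₀ (by norm_num) (half_le_norm_one_sub_mul hM hz ht)
    simpa using this
  have hd : ∀ᶠ z in 𝓝[≠] (0 : ℂ), DifferentiableAt ℂ (Function.update (cauchyInv μ) 0 0) z := by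
    filter_upwards [hsmall, self_mem_nhdsWithin] with z hz hz0
    have hz0 : z ≠ 0 := hz0
    have hp : 0 < ‖z⁻¹‖ := norm_pos_iff.2 (inv_ne_zero hz0)
    have hc : DifferentiableAt ℂ (cauchyInv μ) z := by
      refine differentiableAt_cauchyInv μ hz0 (d := ‖z⁻¹‖ * (1 / 2)) (by positivity) ?_
      filter_upwards [h] with t ht
      have e : z⁻¹ - (t : ℂ) = z⁻¹ * (1 - z * t) := by field_simp
      rw [e, norm_mul]
      exact mul_le_mul_of_nonneg_left (half_le_norm_one_sub_mul hM hz ht) hp.le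
    refine hc.congr_of_eventuallyEq ?_
    filter_upwards [isOpen_ne.mem_nhds hz0] with w hw
    exact Function.update_of_ne hw _ _
  have ha : AnalyticAt ℂ (Function.update (cauchyInv μ) 0 0) 0 :=
    Complex.analyticAt_of_differentiable_on_punctured_nhds_of_continuousAt hd
      (continuousAt_update_same.2 (tendsto_cauchyInv_zero μ le_rfl hb))
  refine ⟨ha, HasDerivAt.deriv (hasDerivAt_iff_tendsto_slope.2 ?_)⟩
  refine (tendsto_cauchyInv_div μ le_rfl hb).congr' ?_
  filter_upwards [self_mem_nhdsWithin] with z hz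
  have hz : z ≠ 0 := hz
  simp [slope_def_field, hz]

/-! ### Compact support implies extension. -/

theorem exists_isAnalyticExtensionOfRTransform (μ : Measure ℝ) [IsProbabilityMeasure μ]
    (hc : IsCompact μ.support) :
    ∃ r : ℝ, 0 < r ∧ ∃ F : ℂ → ℂ, IsAnalyticExtensionOfRTransform μ r F ∧
      ∀ n : ℕ, (iteratedDeriv n F 0).im = 0 := by
  obtain ⟨M, hM, hMb⟩ := hc.isBounded.exists_pos_norm_le
  have hae : ∀ᵐ t ∂μ, |t| ≤ M := by
    filter_upwards [Measure.support_mem_ae (μ := μ)] with t ht using hMb t ht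
  obtain ⟨ha, hderiv⟩ := analyticAt_update_cauchyInv μ hM hae
  have hsymm : ConjSymmetricAtZero (Function.update (cauchyInv μ) 0 0) := by
    refine Eventually.of_forall fun z => ?_
    rcases eq_or_ne z 0 with rfl | hz
    · simp
    · rw [Function.update_of_ne hz, Function.update_of_ne (by simpa using hz), cauchyInv_conj]
  obtain ⟨L, hLa, hL0, hL1, hLs, hLl, -⟩ :=
    ha.exists_conjSymmetric_inverse (by simp) hderiv hsymm
  obtain ⟨F, hFa, hFs, hF⟩ := exists_analytic_inv_sub_inv hLa hL0 hL1 hLs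
  obtain ⟨r, hr, hFb⟩ := Metric.eventually_nhds_iff_ball.1 hFa.eventually_analyticAt
  refine ⟨r, hr, F, ⟨hFb, fun α hα => ?_⟩, hFs.im_iteratedDeriv⟩
  have hball : ∀ᶠ z in 𝓝[lowerCone α] (0 : ℂ), cauchyInv μ z ∈ Metric.ball (0 : ℂ) r :=
    (tendsto_cauchyInv_zero μ (nhdsWithin_lowerCone_le hα) (eventually_lowerCone_bound μ hα))
      (Metric.ball_mem_nhds _ hr)
  have hinv : ∀ᶠ z in 𝓝[lowerCone α] (0 : ℂ), L (cauchyInv μ z) = z := by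
    filter_upwards [nhdsWithin_le_nhds hLl, self_mem_nhdsWithin] with z hz hzc
    rwa [Function.update_of_ne (ne_zero_of_im_neg (im_neg_of_mem_lowerCone hα hzc))] at hz
  filter_upwards [eventually_truncatedCone (hball.and hinv), eventually_injOn_truncatedCone μ hα]
    with β hβ hinj
  refine ⟨?_, ?_⟩
  · rintro _ ⟨z, hz, rfl⟩
    exact (hβ z hz).1
  · rintro _ ⟨z, hz, rfl⟩
    have hL := (hβ z hz).2
    have hne : cauchyInv μ z ≠ 0 := by
      intro h0
      rw [h0, hL0] at hL
      exact ne_zero_of_im_neg (im_neg_of_mem_lowerCone hα hz.1) hL.symm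
    rw [hF _ hne, rTransform, inverseOnCone_cauchyInv hinj hz, hL]

/-! ### Stieltjes inversion. -/

theorem im_inv_sub_ofReal (x ε t : ℝ) :
    (((x : ℂ) + ε * Complex.I - t)⁻¹).im = -(ε / ((x - t) ^ 2 + ε ^ 2)) := by
  rw [Complex.inv_im, Complex.normSq_apply]
  simp
  ring

/-- The mass of an interval is controlled by the imaginary part of the Cauchy transform. -/
theorem measureReal_closedBall_le (μ : Measure ℝ) [IsProbabilityMeasure μ] (x : ℝ) {ε : ℝ}
    (hε : 0 < ε) :
    μ.real (Metric.closedBall x ε) ≤ 2 * ε * -(cauchyTransform μ (x + ε * Complex.I)).im := by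
  have hint : Integrable (fun t : ℝ => ((x : ℂ) + ε * Complex.I - t)⁻¹) μ := by
    refine Integrable.of_bound (by fun_prop : Measurable fun t : ℝ =>
      ((x : ℂ) + ε * Complex.I - t)⁻¹).aestronglyMeasurable ε⁻¹ (Eventually.of_forall fun t => ?_)
    rw [norm_inv]
    refine inv_anti₀ hε ?_
    refine le_trans (le_trans (le_of_eq ?_) (le_abs_self _)) (Complex.abs_im_le_norm _)
    simp
  have him : -(cauchyTransform μ (x + ε * Complex.I)).im =
      ∫ t : ℝ, ε / ((x - t) ^ 2 + ε ^ 2) ∂μ := by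
    have h1 := Complex.imCLM.integral_comp_comm hint
    simp only [Complex.imCLM_apply, im_inv_sub_ofReal, integral_neg] at h1
    rw [cauchyTransform, ← h1, neg_neg]
  have hint' : Integrable (fun t : ℝ => ε / ((x - t) ^ 2 + ε ^ 2)) μ := by
    have := (Complex.imCLM.integrable_comp hint).neg
    refine this.congr (Eventually.of_forall fun t => ?_)
    simp only [Pi.neg_apply, Complex.imCLM_apply, im_inv_sub_ofReal, neg_neg]
  rw [him, ← integral_const_mul, ← integral_indicator_one Metric.isClosed_closedBall.measurableSet]
  refine integral_mono ((integrable_const (1 : ℝ)).indicator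
    Metric.isClosed_closedBall.measurableSet) (hint'.const_mul _) fun t => ?_
  have hpos : 0 < (x - t) ^ 2 + ε ^ 2 := by positivity
  by_cases ht : t ∈ Metric.closedBall x ε
  · simp only [Set.indicator_of_mem ht, Pi.one_apply]
    -- On the interval `(x - t)² + ε² ≤ 2ε²`, whence the factor `2ε`.
    rw [← mul_div_assoc, le_div_iff₀ hpos]
    have h2 : |t - x| ≤ ε := by simpa [Real.dist_eq] using ht
    have h3 := abs_le.1 h2
    nlinarith
  · simp only [Set.indicator_of_notMem ht]
    positivity

/-- A form of Stieltjes inversion. -/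
theorem measure_eq_zero_of_tendsto_im_cauchyTransform (μ : Measure ℝ) [IsProbabilityMeasure μ]
    {s : Set ℝ} (hs : ∀ x ∈ s, Tendsto (fun ε : ℝ => (cauchyTransform μ (x + ε * Complex.I)).im)
      (𝓝[>] 0) (𝓝 0)) : μ s = 0 := by
  have hle : ∀ (n : ℕ) (δ : NNReal), 0 < δ →
      μ (s ∩ Metric.closedBall 0 n) ≤ δ * volume (s ∩ Metric.closedBall (0 : ℝ) n) := by
    intro n δ hδ
    -- Vitali covering: small intervals about each point of `s` have `μ`-mass at most `δ` times
    -- their length.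
    have := (Besicovitch.vitaliFamily μ).measure_le_of_frequently_le (ρ := μ) (δ • volume)
      Measure.AbsolutelyContinuous.rfl (s ∩ Metric.closedBall 0 n) ?_
    · simpa using! this
    · rintro x ⟨hx, -⟩
      refine (Besicovitch.tendsto_filterAt μ x).frequently (Eventually.frequently ?_)
      have hev : ∀ᶠ ε : ℝ in 𝓝[>] 0, -(δ : ℝ) < (cauchyTransform μ (x + ε * Complex.I)).im :=
        (hs x hx).eventually (lt_mem_nhds (by simpa using hδ))
      filter_upwards [hev, self_mem_nhdsWithin] with ε h1 hε
      have hε : 0 < ε := hε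
      have h2 := measureReal_closedBall_le μ x hε
      have h3 : μ.real (Metric.closedBall x ε) ≤ δ * (2 * ε) := by nlinarith
      rw [Measure.smul_apply, Real.volume_closedBall, ← ofReal_measureReal, ENNReal.smul_def,
        smul_eq_mul, ← ENNReal.ofReal_coe_nnreal, ← ENNReal.ofReal_mul δ.coe_nonneg]
      exact ENNReal.ofReal_le_ofReal h3
  have hzero : ∀ n : ℕ, μ (s ∩ Metric.closedBall 0 n) = 0 := by
    intro n
    have hfin : volume (s ∩ Metric.closedBall (0 : ℝ) n) ≠ ⊤ :=
      ((measure_mono Set.inter_subset_right).trans_lt measure_closedBall_lt_top).ne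
    have ht : Tendsto (fun δ : NNReal => (δ : ENNReal) *
        volume (s ∩ Metric.closedBall (0 : ℝ) n)) (𝓝[>] 0) (𝓝 0) := by
      have h1 : Tendsto (fun δ : NNReal => (δ : ENNReal)) (𝓝[>] 0) (𝓝 0) := by
        have := (ENNReal.continuous_coe.tendsto (0 : NNReal)).mono_left
          (nhdsWithin_le_nhds (s := Set.Ioi 0))
        simpa using this
      simpa using ENNReal.Tendsto.mul_const h1 (Or.inr hfin)
    refine le_antisymm (ge_of_tendsto ht ?_) bot_le
    filter_upwards [self_mem_nhdsWithin] with δ hδ using hle n δ hδ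
  have hU : s = ⋃ n : ℕ, s ∩ Metric.closedBall 0 n := by
    rw [← Set.inter_iUnion, Metric.iUnion_closedBall_nat, Set.inter_univ]
  rw [hU]
  exact measure_iUnion_null hzero

/-! ### Extension implies compact support. -/

theorem isCompact_support_of_isAnalyticExtension (μ : Measure ℝ) [IsProbabilityMeasure μ]
    {r : ℝ} (hr : 0 < r) {F : ℂ → ℂ} (hF : IsAnalyticExtensionOfRTransform μ r F)
    (hreal : ∀ n : ℕ, (iteratedDeriv n F 0).im = 0) : IsCompact μ.support := by
  have hFa : AnalyticAt ℂ F 0 := hF.analytic 0 (Metric.mem_ball_self hr)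
  obtain ⟨hΛa, hΛ1, hΛs⟩ := analyticAt_div_one_add_mul hFa (hFa.conjSymmetricAtZero hreal)
  obtain ⟨h, ha, -, -, hs, hleft, -⟩ :=
    hΛa.exists_conjSymmetric_inverse (by simp) hΛ1 hΛs
  obtain ⟨ρ, hρ, hb⟩ := Metric.eventually_nhds_iff_ball.1 (ha.eventually_analyticAt.and hs)
  have hbound := eventually_lowerCone_bound μ one_pos
  have hlim := tendsto_cauchyInv_zero μ (nhdsWithin_lowerCone_le one_pos) hbound
  have hne : ∀ᶠ z in 𝓝[lowerCone 1] (0 : ℂ), cauchyInv μ z ≠ 0 := by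
    filter_upwards [(tendsto_cauchyInv_div μ (nhdsWithin_lowerCone_le one_pos) hbound).eventually_ne
      one_ne_zero] with z hz h0
    simp [h0] at hz
  -- `z ↦ G_μ(1/z)` agrees with the analytic germ `h` on a small cone.
  obtain ⟨β, ⟨⟨hβ1, hβ2⟩, hβ3⟩, hβ0, hβρ⟩ := ((((hF.eqOn 1 one_pos).and
    (eventually_injOn_truncatedCone μ one_pos)).and
    (eventually_truncatedCone ((hlim.eventually hleft).and hne))).and
    (Ioo_mem_nhdsGT hρ)).exists
  have hcone : ∀ z ∈ truncatedCone 1 β, cauchyInv μ z = h z := by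
    intro z hz
    obtain ⟨h1, h2⟩ := hβ3 z hz
    have h3 := hβ1.2 (Set.mem_image_of_mem _ hz)
    rw [rTransform, inverseOnCone_cauchyInv hβ2 hz] at h3
    have hz0 := ne_zero_of_im_neg (im_neg_of_mem_lowerCone one_pos hz.1)
    have h4 : cauchyInv μ z / (1 + cauchyInv μ z * F (cauchyInv μ z)) = z := by
      rw [h3]
      field_simp
      simp [h2]
    rw [h4] at h1
    exact h1.symm
  have hUc : Convex ℝ ({z : ℂ | z.im < 0} ∩ Metric.ball 0 ρ) :=
    (convex_halfSpace_im_lt 0).inter (convex_ball _ _)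
  have hopen : IsOpen (truncatedCone 1 β) :=
    (isOpen_lt (f := fun z : ℂ => |z.re|) (g := fun z => -1 * z.im)
      (by fun_prop) (by fun_prop)).inter (isOpen_lt continuous_norm continuous_const)
  have hz₀ : -((β / 2 : ℝ) * Complex.I) ∈ truncatedCone 1 β := by
    refine ⟨by simp [hβ0], ?_⟩
    rw [norm_neg, norm_mul, Complex.norm_I, mul_one, Complex.norm_real, Real.norm_eq_abs,
      abs_of_pos (half_pos hβ0)]
    exact half_lt_self hβ0
  -- Agreement near one point of the cone spreads over the convex half-disc.
  have hEq : Set.EqOn (cauchyInv μ) h ({z : ℂ | z.im < 0} ∩ Metric.ball 0 ρ) := by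
    refine AnalyticOnNhd.eqOn_of_preconnected_of_eventuallyEq (𝕜 := ℂ) ?_
      (fun z hz => (hb z hz.2).1) hUc.isPreconnected
      ⟨im_neg_of_mem_lowerCone one_pos hz₀.1, by simpa using hz₀.2.trans hβρ⟩
      (mem_of_superset (hopen.mem_nhds hz₀) hcone)
    refine DifferentiableOn.analyticOnNhd (fun z hz => ?_)
      ((isOpen_lt Complex.continuous_im continuous_const).inter Metric.isOpen_ball)
    exact (differentiableAt_cauchyInv_of_im_neg μ hz.1).differentiableWithinAt
  have hnull : μ {x : ℝ | ρ⁻¹ < |x|} = 0 := by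
    refine measure_eq_zero_of_tendsto_im_cauchyTransform μ fun x hx => ?_
    have hx : ρ⁻¹ < |x| := hx
    have hx0 : (x : ℂ) ≠ 0 := by
      have := (inv_pos.2 hρ).trans hx
      simpa using this
    have hxb : ((x : ℂ))⁻¹ ∈ Metric.ball (0 : ℂ) ρ := by
      simpa using inv_lt_of_inv_lt₀ hρ hx
    have hcur : Tendsto (fun ε : ℝ => ((x : ℂ) + ε * Complex.I)⁻¹) (𝓝[>] 0) (𝓝 (x : ℂ)⁻¹) := by
      have h1 : Continuous fun ε : ℝ => (x : ℂ) + ε * Complex.I := by fun_prop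
      have h2 := (h1.tendsto 0).inv₀ (by simpa using hx0)
      simp only [Complex.ofReal_zero, zero_mul, add_zero] at h2
      exact h2.mono_left nhdsWithin_le_nhds
    -- `x⁻¹` is real and inside the disc where `h` commutes with conjugation.
    have him : (h (x : ℂ)⁻¹).im = 0 := by
      have := (hb _ hxb).2
      rw [map_inv₀, Complex.conj_ofReal] at this
      exact Complex.conj_eq_iff_im.1 this.symm
    have hh := (Complex.continuous_im.tendsto _).comp
      (((hb _ hxb).1.continuousAt.tendsto).comp hcur)
    rw [him] at hh
    refine hh.congr' ?_
    filter_upwards [hcur (Metric.isOpen_ball.mem_nhds hxb), self_mem_nhdsWithin] with ε h1 hε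
    have hε : 0 < ε := hε
    have h2 : (((x : ℂ) + ε * Complex.I)⁻¹).im < 0 := by
      have := im_inv_sub_ofReal x ε 0
      simp only [Complex.ofReal_zero, sub_zero] at this
      rw [this]
      have : 0 < x ^ 2 + ε ^ 2 := by positivity
      exact neg_neg_of_pos (by positivity)
    have h3 := hEq ⟨h2, h1⟩
    rw [cauchyInv, inv_inv] at h3
    simp [h3]
  refine (isCompact_closedBall (0 : ℝ) ρ⁻¹).of_isClosed_subset Measure.isClosed_support
    (Measure.support_subset_of_isClosed Metric.isClosed_closedBall ?_)
  rw [mem_ae_iff]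
  convert hnull using 2
  ext x
  simp

theorem corollary1p6 (μ : Measure ℝ) [IsProbabilityMeasure μ] :
    IsCompact μ.support ↔
      ∃ r : ℝ, 0 < r ∧ ∃ F : ℂ → ℂ, IsAnalyticExtensionOfRTransform μ r F ∧
        ∀ n : ℕ, (iteratedDeriv n F 0).im = 0 := by
  refine ⟨exists_isAnalyticExtensionOfRTransform μ, ?_⟩
  rintro ⟨r, hr, F, hF, hreal⟩
  exact isCompact_support_of_isAnalyticExtension μ hr hF hreal
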